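/- Let $(\mathcal X,\mathcal A)$ be a measurable space with a $\sigma$-finite measure $\lambda$, let $n\ge1$, and let $X_1,\dots,X_n$ be i.i.d. random variables with values in $\mathcal X$, defined on a probability space $(\Omega,\mathcal E,\mathbb P)$, whose common law has a density $s\ge0$ with respect to $\lambda$. Put $N(A)=n^{-1}\sum_{i=1}^n 1_{\{X_i\in A\}}$ for $A\in\mathcal A$, and $H^2(t,t')=\int_{\mathcal X}(\sqrt t-\sqrt{t'})^2\,d\lambda$ for nonnegative $\lambda$-integrable functions $t,t'$. For a finite measurable partition $m$ of $\mathcal X$ into nonempty sets, let $|m|$ be the number of its elements, let $S_m$ be the set of the nonnegative functions of the form $\sum_{I\in m,\ \lambda(I)<\infty}t_I1_I$ with $t_I\in\mathbb R$, let $H^2(s,S_m)=\inf_{t\in S_m}H^2(s,t)$, and let $$\hat s_m=\sum_{I\in m,\ \lambda(I)<\infty}\frac{N(I)}{\lambda(I)}1_I\qquad(\text{with }0/0=0)$$ be the histogram estimator based on $m$. (Almost surely $N(I)=0$ whenever $\lambda(I)=0$.) For two partitions put $m\vee m'=\{I\cap I'\mid I\in m,\ I'\in m',\ I\cap I'\ne\varnothing\}$.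 Let $\mathcal M$ be a finite or countable family of finite measurable partitions of $\mathcal X$ satisfying (H) for some $\delta\ge1$, $|m\vee m'|\le\delta(|m|+|m'|)$ for all $m,m'\in\mathcal M$. Let $(\Delta_m)_{m\in\mathcal M}$ be nonnegative weights with $\Sigma=\sum_{m\in\mathcal M}e^{-\Delta_m}<+\infty$, and let $\mathrm{pen}:\mathcal M\to[0,\infty)$ satisfy $$\mathrm{pen}(m)\ge n^{-1}\left(8\delta|m|+202\Delta_m\right)\qquad\text{for all }m\in\mathcal M .$$ For $m\ne m'$ in $\mathcal M$ consider the statistic $$T_{m,m'}=H^2(\hat s_m,\hat s_{m\vee m'})-H^2(\hat s_{m'},\hat s_{m\vee m'})+16\left[\mathrm{pen}(m)-\mathrm{pen}(m')\right].$$ The test between $m$ and $m'$ rejects $m$ (and keeps $m'$) if $T_{m,m'}>0$, rejects $m'$ (and keeps $m$) if $T_{m,m'}<0$, and rejects exactly one of the two, chosen in an arbitrary, possibly random, way, if $T_{m,m'}=0$; the tests based on $T_{m,m'}$ and on $T_{m',m}$ are the same. Let $\mathcal R_m$ be the set of all $m'\in\mathcal M$, $m'\ne m$, such that the test between $m$ and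 $m'$ rejects $m$, and let $\mathcal D(m)=\sup_{m'\in\mathcal R_m}H^2(\hat s_m,\hat s_{m'})$ (equal to $0$ if $\mathcal R_m=\varnothing$). Given $\varepsilon>0$, let $\hat m$ be any (measurable) random element of $\mathcal M$ such that, almost surely, $\mathcal D(\hat m)\le\inf_{m\in\mathcal M}\mathcal D(m)+\varepsilon/3$. Then the penalized histogram estimator $\tilde s=\hat s_{\hat m}$ satisfies $$\mathbb E\left[H^2(\tilde s,s)\right]\le\left[390\left(\inf_{m\in\mathcal M}\left\{H^2(s,S_m)+\mathrm{pen}(m)\right\}+\frac{101\,\Sigma^2}{n}\right)+\varepsilon\right]\wedge2 .$$ -/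

import Mathlib

open MeasureTheory ProbabilityTheory
open scoped ENNReal

noncomputable section

namespace PHE

/-- Finite partitions of `𝒳` (nonempty, pairwise disjoint blocks that cover `𝒳`). -/
abbrev Part (𝒳 : Type*) := Finpartition (Set.univ : Set 𝒳)

open scoped Classical in
/-- The partition `m ∨ m'` whose blocks are the nonempty intersections `I ∩ I'` with `I ∈ m`
and `I' ∈ m'`. (Mathlib orders partitions so that this common refinement is the infimum.) -/
def join {𝒳 : Type*} (m m' : Part 𝒳) : Part 𝒳 := m ⊓ m'

/-- The blocks of `m ∨ m'` are the nonempty intersections of a block of `m` and one of `m'`. -/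
theorem mem_join_parts {𝒳 : Type*} (m m' : Part 𝒳) (A : Set 𝒳) :
    A ∈ (join m m').parts ↔ (∃ I ∈ m.parts, ∃ I' ∈ m'.parts, A = I ∩ I') ∧ A.Nonempty := by
  classical
  simp only [join, Finpartition.parts_inf, Finset.mem_erase, Finset.mem_image, Finset.mem_product,
    Prod.exists, Set.bot_eq_empty, Set.nonempty_iff_ne_empty, Set.inf_eq_inter, ne_eq]
  constructor
  · rintro ⟨h, I, I', ⟨hI, hI'⟩, rfl⟩
    exact ⟨⟨I, hI, I', hI', rfl⟩, h⟩
  · rintro ⟨⟨I, hI, I', hI', rfl⟩, h⟩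
    exact ⟨h, I, I', ⟨hI, hI'⟩, rfl⟩

variable {𝒳 : Type*} [MeasurableSpace 𝒳]

/-- Squared Hellinger-type distance `H²(t,t') = ∫ (√t - √t')² dμ`, with values in `[0,∞]`. -/
def hellSq (μ : Measure 𝒳) (t t' : 𝒳 → ℝ) : ℝ≥0∞ :=
  ∫⁻ x, ENNReal.ofReal ((√(t x) - √(t' x)) ^ 2) ∂μ

/-- `H²(t,F) = inf_{f ∈ F} H²(t,f)`. -/
def hellSqSet (μ : Measure 𝒳) (t : 𝒳 → ℝ) (F : Set (𝒳 → ℝ)) : ℝ≥0∞ :=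
  ⨅ f ∈ F, hellSq μ t f

/-- The cone of nonnegative, measurable and `μ`-integrable functions. -/
def cone (μ : Measure 𝒳) : Set (𝒳 → ℝ) :=
  {t | Measurable t ∧ (∀ x, 0 ≤ t x) ∧ Integrable t μ}

/-- The measurable sets of finite measure. -/
def finiteSets (μ : Measure 𝒳) : Set (Set 𝒳) := {A | MeasurableSet A ∧ μ A < ∞}

open scoped Classical in
/-- The function `∑_{I ∈ m, μ(I) < ∞} c_I 1_I`. -/
def piecewise (μ : Measure 𝒳) (m : Part 𝒳) (c : Set 𝒳 → ℝ) : 𝒳 → ℝ :=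
  fun x => ∑ I ∈ m.parts with I ∈ finiteSets μ, I.indicator (fun _ => c I) x

/-- The model `S_m`: nonnegative functions, constant on the blocks of `m` of finite measure and
zero elsewhere. -/
def model (μ : Measure 𝒳) (m : Part 𝒳) : Set (𝒳 → ℝ) :=
  {t | ∃ c : Set 𝒳 → ℝ, t = piecewise μ m c} ∩ cone μ

/-- The empirical distribution `N(A) = n⁻¹ ∑ᵢ 1_{xᵢ ∈ A}` of the sample `x₁, …, xₙ`. -/
def empirical {n : ℕ} (x : Fin n → 𝒳) (A : Set 𝒳) : ℝ :=
  (n : ℝ)⁻¹ * ∑ i, A.indicator (fun _ => (1 : ℝ)) (x i)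

/-- The histogram estimator `ŝ_m = ∑_{I ∈ m, μ(I) < ∞} (N(I) / μ(I)) 1_I`, with `0 / 0 = 0`
(almost surely `N(I) = 0` whenever `μ(I) = 0`). -/
def hist (μ : Measure 𝒳) {n : ℕ} (x : Fin n → 𝒳) (m : Part 𝒳) : 𝒳 → ℝ :=
  piecewise μ m (fun I => empirical x I / μ.real I)

/-- The test statistic
`T_{m,m'} = H²(ŝ_m, ŝ_{m ∨ m'}) - H²(ŝ_{m'}, ŝ_{m ∨ m'}) + 16 (pen m - pen m')`.
Both distances are finite, since histogram estimators are integrable. -/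
def testStat (μ : Measure 𝒳) {n : ℕ} (x : Fin n → 𝒳) (pen : Part 𝒳 → ℝ) (m m' : Part 𝒳) : ℝ :=
  (hellSq μ (hist μ x m) (hist μ x (join m m'))).toReal
    - (hellSq μ (hist μ x m') (hist μ x (join m m'))).toReal + 16 * (pen m - pen m')

/-- `τ m m'` says that `m` is the one rejected if the test between `m` and `m'` has to break a
tie; exactly one of two distinct partitions is rejected, and the tests for `(m, m')` and for
`(m', m)` are the same. -/
def IsTieBreak (τ : Part 𝒳 → Part 𝒳 → Prop) : Prop :=
  ∀ m m', m ≠ m' → (τ m m' ↔ ¬ τ m' m)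

/-- The set `R_m` of the `m' ∈ 𝓜`, `m' ≠ m`, such that the test between `m` and `m'` rejects
`m`, that is, `T_{m,m'} > 0`, or `T_{m,m'} = 0` and the tie is broken against `m`. -/
def rejecting (μ : Measure 𝒳) {n : ℕ} (x : Fin n → 𝒳) (𝓜 : Set (Part 𝒳)) (pen : Part 𝒳 → ℝ)
    (τ : Part 𝒳 → Part 𝒳 → Prop) (m : Part 𝒳) : Set (Part 𝒳) :=
  {m' | m' ∈ 𝓜 ∧ m' ≠ m ∧
    (0 < testStat μ x pen m m' ∨ (testStat μ x pen m m' = 0 ∧ τ m m'))}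

/-- The criterion `D(m) = sup_{m' ∈ R_m} H²(ŝ_m, ŝ_{m'})` (zero if `R_m` is empty). -/
def crit (μ : Measure 𝒳) {n : ℕ} (x : Fin n → 𝒳) (𝓜 : Set (Part 𝒳)) (pen : Part 𝒳 → ℝ)
    (τ : Part 𝒳 → Part 𝒳 → Prop) (m : Part 𝒳) : ℝ≥0∞ :=
  ⨆ m' ∈ rejecting μ x 𝓜 pen τ m, hellSq μ (hist μ x m) (hist μ x m')

/-- `m` is an admissible choice of the selected partition:
`m ∈ 𝓜` and `D(m) ≤ inf_{m' ∈ 𝓜} D(m') + ε / 3`. -/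
def IsSelected (μ : Measure 𝒳) {n : ℕ} (x : Fin n → 𝒳) (𝓜 : Set (Part 𝒳)) (pen : Part 𝒳 → ℝ)
    (τ : Part 𝒳 → Part 𝒳 → Prop) (ε : ℝ) (m : Part 𝒳) : Prop :=
  m ∈ 𝓜 ∧ crit μ x 𝓜 pen τ m ≤ (⨅ m' ∈ 𝓜, crit μ x 𝓜 pen τ m') + ENNReal.ofReal (ε / 3)

end PHE

end

/-! The argument separates a deterministic comparison from one exponential moment bound. Write V for
`join m m'` and e for the squared distance between the histogram on V and the block means of s on V.

Deterministic part. A coarse histogram is the block average of a finer one, and by convexity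
averaging contracts the distance to functions constant on the blocks. Passing through any t in the
model of m gives H²(ŝ_m, ŝ_V) ≤ 8e + 8H²(s,t) (`hellSq_hist_join_le`). If e ≤ pen(m) + pen(m') + g
and the test does not favour m, the factor 16 in the statistic makes pen(m') cancel, and H²(ŝ_m,
ŝ_m') is bounded in terms of m alone (`hellSq_hist_le_of_testStat_nonneg`). So D(m) is small for a
good m. Of m and the selected partition one rejects the other, so their histograms are at distance
at most D(m) + ε/3 (`hellSq_hist_selected_le`).

Random part. On a partition with D blocks, exp of n/4 times the squared Hellinger deviation has
expectation at most exp(2D) (`lintegral_exp_sum_sq_sqrt_empirical_le`): each block's factor is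
dominated by a geometrically weighted sum of Poisson likelihood ratios, and every product of such
ratios has expectation at most 1 under multinomial counts. Summing over all pairs with weights
exp(-Δ_m - Δ_m') gives a variable `devSum` of mean at most S², and y ≤ exp(y) shows that g =
(4/n)·`devSum` works for all pairs at once. Integrating the deterministic bound finishes the proof.
-/

namespace PHE

/-! ### Blocks, refinements and step functions -/

section Partitions

variable {𝒳 : Type*}

theorem exists_mem_part (m : Part 𝒳) (x : 𝒳) : ∃ I ∈ m.parts, x ∈ I := by
  have h : x ∈ m.parts.sup id := by rw [m.sup_parts]; trivial
  rw [Finset.sup_set_eq_biUnion] at h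
  simpa using h

theorem part_eq_of_mem (m : Part 𝒳) {I J : Set 𝒳} (hI : I ∈ m.parts) (hJ : J ∈ m.parts) {x : 𝒳}
    (hxI : x ∈ I) (hxJ : x ∈ J) : I = J := by
  by_contra hne
  exact Set.disjoint_left.1 (m.disjoint hI hJ hne) hxI hxJ

theorem part_nonempty (m : Part 𝒳) {I : Set 𝒳} (hI : I ∈ m.parts) : I.Nonempty :=
  Set.nonempty_iff_ne_empty.2 (m.ne_bot hI)

theorem join_comm (m m' : Part 𝒳) : join m m' = join m' m := by
  simp only [join, inf_comm]

theorem join_self (m : Part 𝒳) : join m m = m := by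
  simp only [join, inf_idem]

theorem exists_part_superset_of_mem_join {m m' : Part 𝒳} {J : Set 𝒳}
    (hJ : J ∈ (join m m').parts) : ∃ I ∈ m.parts, J ⊆ I := by
  obtain ⟨⟨I, hI, I', -, rfl⟩, -⟩ := (mem_join_parts m m' J).1 hJ
  exact ⟨I, hI, Set.inter_subset_left⟩

theorem sum_indicator_parts (m : Part 𝒳) (f : 𝒳 → ℝ) (x : 𝒳) :
    ∑ I ∈ m.parts, I.indicator f x = f x := by
  obtain ⟨I, hI, hx⟩ := exists_mem_part m x
  rw [Finset.sum_eq_single I, Set.indicator_of_mem hx]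
  · intro J hJ hne
    exact Set.indicator_of_notMem (fun hxJ => hne (part_eq_of_mem m hJ hI hxJ hx)) f
  · exact fun h => absurd hI h

variable [MeasurableSpace 𝒳]

theorem measurableSet_of_mem_join {m m' : Part 𝒳} (hm : ∀ I ∈ m.parts, MeasurableSet I)
    (hm' : ∀ I ∈ m'.parts, MeasurableSet I) : ∀ J ∈ (join m m').parts, MeasurableSet J := by
  intro J hJ
  obtain ⟨⟨I, hI, I', hI', rfl⟩, -⟩ := (mem_join_parts m m' J).1 hJ
  exact (hm I hI).inter (hm' I' hI')

theorem lintegral_eq_sum_parts (μ : Measure 𝒳) {m : Part 𝒳}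
    (hm : ∀ I ∈ m.parts, MeasurableSet I) (f : 𝒳 → ℝ≥0∞) :
    ∫⁻ x, f x ∂μ = ∑ I ∈ m.parts, ∫⁻ x in I, f x ∂μ := by
  have hU : (⋃ I ∈ m.parts, id I) = Set.univ := by
    rw [← Finset.sup_set_eq_biUnion, m.sup_parts]
  have h := lintegral_biUnion_finset (μ := μ) m.disjoint hm f
  rwa [hU, Measure.restrict_univ] at h

theorem piecewise_apply (μ : Measure 𝒳) (m : Part 𝒳) (c : Set 𝒳 → ℝ) {I : Set 𝒳}
    (hI : I ∈ m.parts) {x : 𝒳} (hx : x ∈ I) [Decidable (I ∈ finiteSets μ)] :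
    piecewise μ m c x = if I ∈ finiteSets μ then c I else 0 := by
  classical
  rw [piecewise, Finset.sum_filter, Finset.sum_eq_single I]
  · rw [Set.indicator_of_mem hx]; congr
  · intro J hJ hne
    rw [Set.indicator_of_notMem (fun hxJ => hne (part_eq_of_mem m hJ hI hxJ hx)), ite_self]
  · exact fun h => absurd hI h

theorem measurable_piecewise (μ : Measure 𝒳) (m : Part 𝒳) (c : Set 𝒳 → ℝ) :
    Measurable (piecewise μ m c) := by
  classical
  refine Finset.measurable_sum _ fun I hI => ?_
  exact measurable_const.indicator (Finset.mem_filter.1 hI).2.1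

theorem integrable_piecewise (μ : Measure 𝒳) (m : Part 𝒳) (c : Set 𝒳 → ℝ) :
    Integrable (piecewise μ m c) μ := by
  classical
  refine integrable_finsetSum _ fun I hI => ?_
  have := (Finset.mem_filter.1 hI).2
  exact (integrable_indicator_iff this.1).2 (integrableOn_const this.2.ne)

theorem piecewise_nonneg (μ : Measure 𝒳) (m : Part 𝒳) {c : Set 𝒳 → ℝ} (hc : ∀ I, 0 ≤ c I)
    (x : 𝒳) : 0 ≤ piecewise μ m c x := by
  classical
  exact Finset.sum_nonneg fun I _ => Set.indicator_nonneg (fun _ _ => hc I) x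

theorem piecewise_mem_cone (μ : Measure 𝒳) (m : Part 𝒳) {c : Set 𝒳 → ℝ} (hc : ∀ I, 0 ≤ c I) :
    piecewise μ m c ∈ cone μ :=
  ⟨measurable_piecewise μ m c, piecewise_nonneg μ m hc, integrable_piecewise μ m c⟩

/-- `t` is a nonnegative constant on every block, the constant being zero on blocks of infinite
measure. -/
def IsStep (μ : Measure 𝒳) (m : Part 𝒳) (t : 𝒳 → ℝ) : Prop :=
  ∀ I ∈ m.parts, ∃ c, 0 ≤ c ∧ (μ I = ∞ → c = 0) ∧ ∀ x ∈ I, t x = c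

theorem isStep_of_mem_model {μ : Measure 𝒳} {m : Part 𝒳} {t : 𝒳 → ℝ} (ht : t ∈ model μ m) :
    IsStep μ m t := by
  classical
  obtain ⟨⟨c, rfl⟩, -, h0, -⟩ := ht
  intro I hI
  obtain ⟨x, hx⟩ := part_nonempty m hI
  refine ⟨piecewise μ m c x, h0 x, fun h => ?_, fun y hy => ?_⟩
  · rw [piecewise_apply μ m c hI hx, if_neg]
    exact fun hf => hf.2.ne h
  · rw [piecewise_apply μ m c hI hx, piecewise_apply μ m c hI hy]

theorem IsStep.join {μ : Measure 𝒳} {m m' : Part 𝒳} {t : 𝒳 → ℝ} (ht : IsStep μ m t) :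
    IsStep μ (join m m') t := by
  intro J hJ
  obtain ⟨I, hI, hJI⟩ := exists_part_superset_of_mem_join hJ
  obtain ⟨c, hc, hc', h⟩ := ht I hI
  exact ⟨c, hc, fun hJ => hc' (measure_mono_top hJI hJ), fun x hx => h x (hJI hx)⟩

end Partitions

/-! ### Quasi-triangle inequalities and contraction under averaging -/

section Hellinger

variable {𝒳 : Type*} [MeasurableSpace 𝒳] {μ : Measure 𝒳}

theorem hellSq_comm (f g : 𝒳 → ℝ) : hellSq μ f g = hellSq μ g f := by
  simp only [hellSq]
  congr 1; ext x; congr 1; ring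

theorem hellSq_self (f : 𝒳 → ℝ) : hellSq μ f f = 0 := by
  simp [hellSq]

theorem hellSq_le_add {a b : ℝ} (ha : 0 ≤ a) (hb : 0 ≤ b)
    (hab : ∀ u v : ℝ, (u + v) ^ 2 ≤ a * u ^ 2 + b * v ^ 2) {f g h : 𝒳 → ℝ} (hf : Measurable f)
    (hg : Measurable g) :
    hellSq μ f h ≤ ENNReal.ofReal a * hellSq μ f g + ENNReal.ofReal b * hellSq μ g h := by
  have hm : Measurable fun x => ENNReal.ofReal ((√(f x) - √(g x)) ^ 2) := by fun_prop
  simp only [hellSq]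
  rw [← lintegral_const_mul _ hm, ← lintegral_const_mul' _ _ ENNReal.ofReal_ne_top,
    ← lintegral_add_left (hm.const_mul _)]
  refine lintegral_mono fun x => ?_
  rw [← ENNReal.ofReal_mul ha, ← ENNReal.ofReal_mul hb,
    ← ENNReal.ofReal_add (by positivity) (by positivity)]
  refine ENNReal.ofReal_le_ofReal (le_trans (le_of_eq ?_) (hab _ _))
  ring

theorem hellSq_le_two_add_two {f g h : 𝒳 → ℝ} (hf : Measurable f) (hg : Measurable g) :
    hellSq μ f h ≤ 2 * hellSq μ f g + 2 * hellSq μ g h := by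
  have := hellSq_le_add (μ := μ) (a := 2) (b := 2) (by norm_num) (by norm_num)
    (fun u v => by nlinarith [sq_nonneg (u - v)]) (h := h) hf hg
  simpa using this

/-- The weight 3 on the first distance turns the slack ε/3 of the selection rule into ε. -/
theorem hellSq_le_three_add_two {f g h : 𝒳 → ℝ} (hf : Measurable f) (hg : Measurable g) :
    hellSq μ f h ≤ 3 * hellSq μ f g + 2 * hellSq μ g h := by
  have := hellSq_le_add (μ := μ) (a := 3) (b := 2) (by norm_num) (by norm_num)
    (fun u v => by nlinarith [sq_nonneg (2 * u - v), sq_nonneg u]) (h := h) hf hg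
  simpa using this

theorem hellSq_le_lintegral_add {f g : 𝒳 → ℝ} (hf : Measurable f) (hf0 : ∀ x, 0 ≤ f x)
    (hg0 : ∀ x, 0 ≤ g x) :
    hellSq μ f g ≤ ∫⁻ x, ENNReal.ofReal (f x) ∂μ + ∫⁻ x, ENNReal.ofReal (g x) ∂μ := by
  rw [← lintegral_add_left hf.ennreal_ofReal]
  refine lintegral_mono fun x => ?_
  rw [← ENNReal.ofReal_add (hf0 x) (hg0 x)]
  refine ENNReal.ofReal_le_ofReal ?_
  nlinarith [Real.sq_sqrt (hf0 x), Real.sq_sqrt (hg0 x),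
    mul_nonneg (Real.sqrt_nonneg (f x)) (Real.sqrt_nonneg (g x))]

/-- Tangent line inequality for the convex function `u ↦ (√u - √c)²` at `b > 0`. -/
theorem sq_sqrt_sub_sqrt_tangent {u b : ℝ} (c : ℝ) (hu : 0 ≤ u) (hb : 0 < b) :
    (√b - √c) ^ 2 + (1 - √c / √b) * (u - b) ≤ (√u - √c) ^ 2 := by
  have hb' : 0 < √b := Real.sqrt_pos.2 hb
  have h1 : √u ^ 2 = u := Real.sq_sqrt hu
  have h2 : √b ^ 2 = b := Real.sq_sqrt hb.le
  -- This is exactly the gap between the curve and its tangent.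
  have h3 : √c / √b * (√u - √b) ^ 2 ≥ 0 := by positivity
  have h4 : √c / √b * √b = √c := by field_simp
  have : √c / √b * (√u - √b) ^ 2 = √c / √b * (u - b) - 2 * √c * (√u - √b) := by
    rw [← h1, ← h2]
    simp only [Real.sqrt_sq (Real.sqrt_nonneg _)]
    linear_combination (2 * √b - 2 * √u) * h4
  nlinarith

/-- Averaging over a set does not increase the squared Hellinger distance to a constant. -/
theorem setLIntegral_average_le {f : 𝒳 → ℝ} (hf : f ∈ cone μ) {I : Set 𝒳}
    (hfin : μ I ≠ ∞) {b : ℝ} (hb : b * μ.real I = ∫ x in I, f x ∂μ) (hb0 : 0 ≤ b) (c : ℝ) :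
    ∫⁻ _ in I, ENNReal.ofReal ((√b - √c) ^ 2) ∂μ ≤
      ∫⁻ x in I, ENNReal.ofReal ((√(f x) - √c) ^ 2) ∂μ := by
  obtain ⟨hfm, hf0, hfi⟩ := hf
  -- At b = 0 no tangent line is available, but then f vanishes almost everywhere on I.
  rcases hb0.eq_or_lt with rfl | hbpos
  · rw [zero_mul, eq_comm, setIntegral_eq_zero_iff_of_nonneg_ae (ae_of_all _ hf0)
      hfi.integrableOn] at hb
    refine lintegral_mono_ae ?_
    filter_upwards [hb] with x hx
    rw [hx]; rfl
  have : IsFiniteMeasure (μ.restrict I) := ⟨by simpa using hfin.lt_top⟩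
  have hint : Integrable (fun x => (√(f x) - √c) ^ 2) (μ.restrict I) := by
    refine ((hfi.integrableOn (s := I)).const_mul 2 |>.add
      (integrable_const (2 * √c ^ 2))).mono' (by fun_prop) (ae_of_all _ fun x => ?_)
    rw [Real.norm_of_nonneg (by positivity)]
    simp only [Pi.add_apply]
    nlinarith [Real.sq_sqrt (hf0 x), sq_nonneg (√(f x) + √c)]
  rw [← ofReal_integral_eq_lintegral_ofReal hint (ae_of_all _ fun x => sq_nonneg _),
    ← ofReal_integral_eq_lintegral_ofReal (integrable_const _) (ae_of_all _ fun x => sq_nonneg _)]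
  refine ENNReal.ofReal_le_ofReal ?_
  have hd : Integrable (fun x => f x - b) (μ.restrict I) :=
    hfi.integrableOn.sub (integrable_const b)
  have hz : ∫ x in I, (f x - b) ∂μ = 0 := by
    rw [integral_sub hfi.integrableOn (integrable_const b), ← hb]
    simp [mul_comm]
  -- Jensen's inequality: the linear term of the tangent integrates to zero because b is the mean of
  -- f.
  calc ∫ _ in I, (√b - √c) ^ 2 ∂μ
      = ∫ x in I, ((√b - √c) ^ 2 + (1 - √c / √b) * (f x - b)) ∂μ := by
        rw [integral_add (integrable_const _) (hd.const_mul _), integral_const_mul, hz]; simp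
    _ ≤ ∫ x in I, (√(f x) - √c) ^ 2 ∂μ :=
        integral_mono ((integrable_const _).add (hd.const_mul _)) hint
          fun x => sq_sqrt_sub_sqrt_tangent c (hf0 x) hbpos

/-- Averaging over the blocks of a partition does not increase the squared Hellinger distance to
the functions that are constant on the blocks. -/
theorem hellSq_average_le {m : Part 𝒳} (hm : ∀ I ∈ m.parts, MeasurableSet I) {f t : 𝒳 → ℝ}
    (hf : f ∈ cone μ) (ht : IsStep μ m t) {b : Set 𝒳 → ℝ} (hb0 : ∀ I, 0 ≤ b I)
    (hb : ∀ I ∈ m.parts, μ I ≠ 0 → μ I ≠ ∞ → b I * μ.real I = ∫ x in I, f x ∂μ) :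
    hellSq μ (piecewise μ m b) t ≤ hellSq μ f t := by
  classical
  simp only [hellSq]
  rw [lintegral_eq_sum_parts μ hm, lintegral_eq_sum_parts μ hm]
  refine Finset.sum_le_sum fun I hI => ?_
  obtain ⟨c, hc, hc', htc⟩ := ht I hI
  by_cases h0 : μ I = 0
  · simp [Measure.restrict_eq_zero.2 h0]
  by_cases hinf : μ I = ∞
  · refine le_of_eq_of_le ?_ zero_le
    rw [setLIntegral_congr_fun (g := fun _ => 0) (hm I hI), lintegral_zero]
    intro x hx
    simp only
    rw [piecewise_apply μ m b hI hx, if_neg (fun h => h.2.ne hinf), htc x hx, hc' hinf]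
    simp
  have hIf : I ∈ finiteSets μ := ⟨hm I hI, lt_top_iff_ne_top.2 hinf⟩
  rw [setLIntegral_congr_fun (g := fun _ => ENNReal.ofReal ((√(b I) - √c) ^ 2)) (hm I hI),
    setLIntegral_congr_fun (f := fun x => ENNReal.ofReal ((√(f x) - √(t x)) ^ 2))
      (g := fun x => ENNReal.ofReal ((√(f x) - √c) ^ 2)) (hm I hI)]
  · exact setLIntegral_average_le hf hinf (hb I hI h0 hinf) (hb0 I) c
  · intro x hx
    simp only [htc x hx]
  · intro x hx
    simp only
    rw [piecewise_apply μ m b hI hx, if_pos hIf, htc x hx]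

/-- On a block of positive finite measure the common factor 1/μ(I) cancels against the measure of
the block. Blocks of null or infinite measure contribute nothing on the left, hence only an
inequality. -/
theorem hellSq_piecewise_le {m : Part 𝒳} (hm : ∀ I ∈ m.parts, MeasurableSet I)
    (a b : Set 𝒳 → ℝ) (ha : ∀ I, 0 ≤ a I) (hb : ∀ I, 0 ≤ b I) :
    hellSq μ (piecewise μ m fun I => a I / μ.real I) (piecewise μ m fun I => b I / μ.real I) ≤
      ENNReal.ofReal (∑ I ∈ m.parts, (√(a I) - √(b I)) ^ 2) := by
  classical
  simp only [hellSq]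
  rw [lintegral_eq_sum_parts μ hm, ENNReal.ofReal_sum_of_nonneg fun _ _ => sq_nonneg _]
  refine Finset.sum_le_sum fun I hI => ?_
  have hcongr := setLIntegral_congr_fun (μ := μ) (f := fun x => ENNReal.ofReal
    ((√(piecewise μ m (fun I => a I / μ.real I) x) -
      √(piecewise μ m (fun I => b I / μ.real I) x)) ^ 2)) (g := fun _ => ENNReal.ofReal
    ((√(if I ∈ finiteSets μ then a I / μ.real I else 0) -
      √(if I ∈ finiteSets μ then b I / μ.real I else 0)) ^ 2)) (hm I hI) (by
    intro x hx
    simp only [piecewise_apply μ m _ hI hx])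
  rw [hcongr, lintegral_const, Measure.restrict_apply_univ]
  by_cases hIf : I ∈ finiteSets μ
  · simp only [if_pos hIf]
    rw [← ENNReal.ofReal_toReal hIf.2.ne, ← ENNReal.ofReal_mul (sq_nonneg _)]
    refine ENNReal.ofReal_le_ofReal ?_
    change (√(a I / μ.real I) - √(b I / μ.real I)) ^ 2 * μ.real I ≤ _
    rcases (measureReal_nonneg (μ := μ) (s := I)).eq_or_lt with h | h
    · rw [← h, mul_zero]; positivity
    · rw [Real.sqrt_div (ha I), Real.sqrt_div (hb I), ← sub_div, div_pow,
        Real.sq_sqrt h.le, div_mul_cancel₀ _ h.ne']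
  · simp [if_neg hIf]

end Hellinger

/-! ### Histograms as block averages -/

section Histogram

variable {𝒳 : Type*}

theorem empirical_nonneg {n : ℕ} (x : Fin n → 𝒳) (A : Set 𝒳) : 0 ≤ empirical x A :=
  mul_nonneg (by positivity)
    (Finset.sum_nonneg fun i _ => Set.indicator_nonneg (fun _ _ => zero_le_one) (x i))

theorem sum_empirical_inter {n : ℕ} (x : Fin n → 𝒳) (m : Part 𝒳) (A : Set 𝒳) :
    ∑ J ∈ m.parts, empirical x (J ∩ A) = empirical x A := by
  simp only [empirical]
  rw [← Finset.mul_sum, Finset.sum_comm]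
  congr 1
  refine Finset.sum_congr rfl fun i _ => ?_
  simp only [← Set.indicator_indicator]
  exact sum_indicator_parts m _ _

theorem empirical_empty {n : ℕ} (x : Fin n → 𝒳) : empirical x ∅ = 0 := by
  simp [empirical]

theorem empirical_univ {n : ℕ} (hn : 1 ≤ n) (x : Fin n → 𝒳) : empirical x Set.univ = 1 := by
  have : (n : ℝ) ≠ 0 := by positivity
  simp [empirical, this]

theorem sum_empirical {n : ℕ} (hn : 1 ≤ n) (x : Fin n → 𝒳) (m : Part 𝒳) :
    ∑ J ∈ m.parts, empirical x J = 1 := by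
  rw [← empirical_univ hn x, ← sum_empirical_inter x m Set.univ]
  simp

variable [MeasurableSpace 𝒳] {μ : Measure 𝒳}

theorem hist_mem_cone {n : ℕ} (x : Fin n → 𝒳) (m : Part 𝒳) : hist μ x m ∈ cone μ :=
  piecewise_mem_cone μ m fun _ => div_nonneg (empirical_nonneg _ _) measureReal_nonneg

open scoped Classical in
theorem integral_piecewise (m : Part 𝒳) (c : Set 𝒳 → ℝ) {I : Set 𝒳} :
    ∫ x in I, piecewise μ m c x ∂μ =
      ∑ J ∈ m.parts, if J ∈ finiteSets μ then c J * μ.real (J ∩ I) else 0 := by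
  simp only [piecewise]
  rw [integral_finsetSum, Finset.sum_filter]
  · refine Finset.sum_congr rfl fun J _ => ?_
    by_cases hJ : J ∈ finiteSets μ
    · simp only [if_pos hJ]
      rw [integral_indicator hJ.1, Measure.restrict_restrict hJ.1]
      simp [mul_comm]
    · simp only [if_neg hJ]
  · intro J hJ
    have := (Finset.mem_filter.1 hJ).2
    exact ((integrable_indicator_iff this.1).2 (integrableOn_const this.2.ne)).integrableOn

theorem lintegral_hist_le {n : ℕ} (hn : 1 ≤ n) (x : Fin n → 𝒳) (m : Part 𝒳) :
    ∫⁻ y, ENNReal.ofReal (hist μ x m y) ∂μ ≤ 1 := by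
  classical
  obtain ⟨-, h0, hi⟩ := hist_mem_cone (μ := μ) x m
  rw [← ofReal_integral_eq_lintegral_ofReal hi (ae_of_all _ h0), ENNReal.ofReal_le_one,
    ← setIntegral_univ, hist, integral_piecewise, ← sum_empirical hn x m]
  refine Finset.sum_le_sum fun J hJ => ?_
  split_ifs
  · rw [Set.inter_univ]
    rw [div_mul_eq_mul_div]
    exact div_le_of_le_mul₀ measureReal_nonneg (empirical_nonneg x J) le_rfl
  · exact empirical_nonneg x J

/-- If no sample point lies in a null block of `m ∨ m'`, the histogram based on `m` is obtained by
averaging the one based on `m ∨ m'`. -/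
theorem integral_hist_join {n : ℕ} (x : Fin n → 𝒳) {m m' : Part 𝒳}
    (hmeas : ∀ J ∈ (join m m').parts, MeasurableSet J)
    (hnull : ∀ J ∈ (join m m').parts, μ J = 0 → empirical x J = 0) {I : Set 𝒳}
    (hI : I ∈ m.parts) (hfin : μ I ≠ ∞) :
    ∫ y in I, hist μ x (join m m') y ∂μ = empirical x I := by
  classical
  rw [hist, integral_piecewise, ← sum_empirical_inter x (join m m') I]
  refine Finset.sum_congr rfl fun J hJ => ?_
  obtain ⟨I', hI', hJI'⟩ := exists_part_superset_of_mem_join hJ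
  by_cases hne : I' = I
  · subst hne
    have hJfin : μ J ≠ ∞ := fun h => hfin (measure_mono_top hJI' h)
    rw [Set.inter_eq_left.2 hJI', if_pos ⟨hmeas J hJ, lt_top_iff_ne_top.2 hJfin⟩]
    -- With 0/0 = 0 a null block carries no histogram mass, so its empirical mass must vanish as
    -- well.
    by_cases h0 : μ J = 0
    · rw [hnull J hJ h0]; simp
    · exact div_mul_cancel₀ _ ((measureReal_ne_zero_iff hJfin).2 h0)
  · have : J ∩ I = ∅ := Set.disjoint_iff_inter_eq_empty.1
      ((m.disjoint hI' hI hne).mono_left hJI')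
    rw [this, empirical_empty]; simp

theorem hellSq_hist_le_hellSq_hist_join {n : ℕ} (x : Fin n → 𝒳) {m m' : Part 𝒳}
    (hm : ∀ I ∈ m.parts, MeasurableSet I)
    (hmeas : ∀ J ∈ (join m m').parts, MeasurableSet J)
    (hnull : ∀ J ∈ (join m m').parts, μ J = 0 → empirical x J = 0) {t : 𝒳 → ℝ}
    (ht : IsStep μ m t) :
    hellSq μ (hist μ x m) t ≤ hellSq μ (hist μ x (join m m')) t := by
  refine hellSq_average_le hm (hist_mem_cone _ _) ht
    (fun _ => div_nonneg (empirical_nonneg _ _) measureReal_nonneg) fun I hI h0 hfin => ?_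
  rw [integral_hist_join x hmeas hnull hI hfin,
    div_mul_cancel₀ _ ((measureReal_ne_zero_iff hfin).2 h0)]

/-- The function obtained by averaging `s` over the blocks of `m` of finite measure. -/
noncomputable def blockMean (μ : Measure 𝒳) (s : 𝒳 → ℝ) (m : Part 𝒳) : 𝒳 → ℝ :=
  piecewise μ m fun I => (∫ x in I, s x ∂μ) / μ.real I

theorem hellSq_blockMean_le {m : Part 𝒳} (hm : ∀ I ∈ m.parts, MeasurableSet I) {s t : 𝒳 → ℝ}
    (hs : s ∈ cone μ) (ht : IsStep μ m t) : hellSq μ (blockMean μ s m) t ≤ hellSq μ s t := by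
  refine hellSq_average_le hm hs ht
    (fun I => div_nonneg (integral_nonneg hs.2.1) measureReal_nonneg) fun I _ h0 hfin => ?_
  rw [div_mul_cancel₀ _ ((measureReal_ne_zero_iff hfin).2 h0)]

theorem measurable_blockMean (s : 𝒳 → ℝ) (m : Part 𝒳) : Measurable (blockMean μ s m) :=
  measurable_piecewise _ _ _

end Histogram

/-! ### Domination by Poisson likelihood ratios -/

section PoissonBound

open Real in
-- The right side is the likelihood ratio of Poisson(m²) to Poisson(l²) at k. Hypothesis `h` places
-- m between l and √k (or at l), and log(m/l) ≥ 1 - l/m then bounds the log-ratio below by -(m² -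
-- l²) + 2m(m - l) = (m - l)². At m = 0 the convention 0⁰ = 1 is needed, whence `h0`.
theorem exp_sq_le_exp_mul_pow {l m : ℝ} (hl : 0 < l) (hm : 0 ≤ m) {k : ℕ}
    (h : m ^ 2 * (m - l) ≤ k * (m - l)) (h0 : m = 0 → k = 0) :
    exp ((m - l) ^ 2) ≤ exp (-((m ^ 2) - l ^ 2)) * ((m / l) ^ 2) ^ k := by
  rcases hm.eq_or_lt with rfl | hm
  · simp [h0 rfl]
  have hml : 0 < m / l := div_pos hm hl
  have hpow : ((m / l) ^ 2) ^ k = exp (2 * k * log (m / l)) := by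
    rw [← pow_mul, show 2 * (k : ℝ) * log (m / l) = ((2 * k : ℕ) : ℝ) * log (m / l) by
      push_cast; ring, exp_nat_mul, exp_log hml]
  rw [hpow, ← exp_add, exp_le_exp]
  have h1 : 1 - (m / l)⁻¹ ≤ log (m / l) := one_sub_inv_le_log_of_pos hml
  have h2 : m * (1 - (m / l)⁻¹) = m - l := by field_simp
  have h3 : m * (m - l) ≤ k * (1 - (m / l)⁻¹) := by
    have : m * (m * (m - l)) ≤ m * (k * (1 - (m / l)⁻¹)) := by
      calc m * (m * (m - l)) = m ^ 2 * (m - l) := by ring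
        _ ≤ k * (m - l) := h
        _ = _ := by rw [← h2]; ring
    exact le_of_mul_le_mul_left this hm
  have h4 : (k : ℝ) * (1 - (m / l)⁻¹) ≤ k * log (m / l) :=
    mul_le_mul_of_nonneg_left h1 (Nat.cast_nonneg k)
  nlinarith

open Real in
-- Rounding d down to an integer j ≥ 1 loses at most a factor 2, which the division by 4 absorbs
-- with enough surplus for the geometric weight. The prefactor 2 covers j = 0.
theorem exp_sq_div_four_le {d : ℝ} (hd : 0 ≤ d) {j : ℕ} (hj : d ≤ j + 1) :
    exp (d ^ 2 / 4) ≤ 2 * (1 / 2) ^ j * exp ((j : ℝ) ^ 2) := by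
  have h2 : exp (-1) ≤ 1 / 2 := by
    rw [exp_neg, one_div]
    exact inv_anti₀ (by norm_num) (by linarith [exp_one_gt_d9])
  rcases j with - | j
  · have h3 : exp (1 / 4) ≤ 2 := by
      have h5 : exp (1 / 4) * (1 - 1 / 4) ≤ 1 := by
        have := add_one_le_exp (-(1 / 4 : ℝ))
        calc exp (1 / 4) * (1 - 1 / 4) ≤ exp (1 / 4) * exp (-(1 / 4)) :=
              mul_le_mul_of_nonneg_left (by linarith) (exp_pos _).le
          _ = 1 := by rw [← exp_add]; simp
      linarith
    have : exp (d ^ 2 / 4) ≤ exp (1 / 4) := by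
      rw [exp_le_exp]
      push_cast at hj
      nlinarith
    simpa using this.trans h3
  · have h4 : exp (-(j : ℝ)) ≤ (1 / 2) ^ j := by
      rw [show -(j : ℝ) = j * (-1) by ring, exp_nat_mul]
      exact pow_le_pow_left₀ (exp_pos _).le h2 j
    calc exp (d ^ 2 / 4) ≤ exp (-(j : ℝ) + ((j + 1 : ℕ) : ℝ) ^ 2) := by
          rw [exp_le_exp]
          push_cast at hj ⊢
          nlinarith [sq_nonneg (j : ℝ)]
      _ = exp (-(j : ℝ)) * exp (((j + 1 : ℕ) : ℝ) ^ 2) := exp_add _ _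
      _ ≤ (1 / 2) ^ j * exp (((j + 1 : ℕ) : ℝ) ^ 2) :=
          mul_le_mul_of_nonneg_right h4 (exp_pos _).le
      _ = _ := by rw [pow_succ]; ring

open Real in
/-- The exponential of a squared Hellinger deviation is dominated by one of finitely many
exponential functions of `k`, whose Poisson expectations are geometrically small. -/
theorem exists_exp_sq_sqrt_sub_le {l : ℝ} (hl : 0 < l) {k n : ℕ} (hk : k ≤ n) (hln : l ^ 2 ≤ n) :
    ∃ j ∈ Finset.Icc (-(n : ℤ)) n, exp ((√k - l) ^ 2 / 4) ≤
      2 * (1 / 2) ^ j.natAbs * (exp (-((l + j) ^ 2 - l ^ 2)) * (((l + j) / l) ^ 2) ^ k) := by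
  have hk0 : (0 : ℝ) ≤ √k := sqrt_nonneg _
  have hksq : √(k : ℝ) ^ 2 = k := sq_sqrt (Nat.cast_nonneg k)
  have hkn : (k : ℝ) ≤ n := Nat.cast_le.2 hk
  set d := |√(k : ℝ) - l| with hd
  have hd0 : 0 ≤ d := abs_nonneg _
  have hdn : d ^ 2 ≤ n := by
    rw [hd, sq_abs]
    rcases le_total l √k with h | h <;> nlinarith
  -- The witness is ±⌊d⌋, so that l + j lies between l and √k, as the likelihood ratio bound
  -- requires.
  have hj1 := Nat.floor_le hd0
  have hj2 := (Nat.lt_floor_add_one d).le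
  set j := ⌊d⌋₊
  have hjn : j ≤ n := by
    have : ((j ^ 2 : ℕ) : ℝ) ≤ n := by
      push_cast; nlinarith [Nat.cast_nonneg (α := ℝ) j]
    exact (Nat.le_self_pow two_ne_zero j).trans (Nat.cast_le.1 this)
  have hkey : ∀ i : ℤ, i.natAbs = j → 0 ≤ l + i → (l + i) ^ 2 * i ≤ k * i →
      (l + i = 0 → k = 0) → exp ((√k - l) ^ 2 / 4) ≤
      2 * (1 / 2) ^ i.natAbs * (exp (-((l + i) ^ 2 - l ^ 2)) * (((l + i) / l) ^ 2) ^ k) := by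
    intro i hi h1 h2 h3
    have h4 := exp_sq_le_exp_mul_pow hl h1 (k := k) (by simpa using h2) h3
    have h5 := exp_sq_div_four_le hd0 hj2
    have h6 : (l + i - l) ^ 2 = (j : ℝ) ^ 2 := by
      rw [add_sub_cancel_left, ← hi, Nat.cast_natAbs, Int.cast_abs, sq_abs]
    rw [h6] at h4
    rw [hd, sq_abs] at h5
    rw [hi]
    exact h5.trans (mul_le_mul_of_nonneg_left h4 (by positivity))
  have hj0 : (0 : ℝ) ≤ j := Nat.cast_nonneg j
  rcases le_total l √k with h | h
  · rw [hd, abs_of_nonneg (sub_nonneg.2 h)] at hj1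
    refine ⟨j, Finset.mem_Icc.2 ⟨by omega, by omega⟩, hkey j (by simp) ?_ ?_ ?_⟩
    · push_cast; linarith
    · push_cast
      refine mul_le_mul_of_nonneg_right ?_ hj0
      rw [← hksq]
      exact pow_le_pow_left₀ (by linarith) (by linarith) 2
    · push_cast; intro h; linarith
  · rw [hd, abs_of_nonpos (sub_nonpos.2 h)] at hj1
    refine ⟨-j, Finset.mem_Icc.2 ⟨by omega, by omega⟩, hkey (-j) (by simp) ?_ ?_ ?_⟩
    · push_cast; linarith
    · push_cast
      rw [mul_neg, mul_neg, neg_le_neg_iff]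
      refine mul_le_mul_of_nonneg_right ?_ hj0
      rw [← hksq]
      exact pow_le_pow_left₀ hk0 (by linarith) 2
    · push_cast; intro h
      have h0 : √(k : ℝ) = 0 := by linarith
      rw [h0] at hksq
      have : (k : ℝ) = 0 := by rw [← hksq]; norm_num
      exact_mod_cast this

theorem sum_Icc_half_pow_natAbs_le (n : ℕ) :
    ∑ j ∈ Finset.Icc (-(n : ℤ)) n, (1 / 2 : ℝ) ^ j.natAbs ≤ 3 := by
  have h : ∑ j ∈ Finset.Icc (-(n : ℤ)) n, (1 / 2 : ℝ) ^ j.natAbs = 3 - 2 * (1 / 2) ^ n := by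
    induction n with
    | zero => norm_num
    | succ n ih =>
      have : Finset.Icc (-((n + 1 : ℕ) : ℤ)) (n + 1 : ℕ) =
          insert (-((n + 1 : ℕ) : ℤ)) (insert ((n + 1 : ℕ) : ℤ) (Finset.Icc (-(n : ℤ)) n)) := by
        ext j; simp only [Finset.mem_Icc, Finset.mem_insert]; omega
      rw [this, Finset.sum_insert, Finset.sum_insert, ih, Int.natAbs_neg, Int.natAbs_natCast]
      · ring
      · simp
      · simp only [Finset.mem_insert, Finset.mem_Icc]; omega
  rw [h]
  have : (0 : ℝ) < (1 / 2) ^ n := by positivity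
  linarith

end PoissonBound

/-! ### Exponential moments of multinomial counts -/

section Multinomial

variable {𝒳 Ω ι : Type*}

open scoped Classical in
/-- The number of sample points that lie in `A`. -/
noncomputable def count {n : ℕ} (x : Fin n → 𝒳) (A : Set 𝒳) : ℕ :=
  (Finset.univ.filter fun i => x i ∈ A).card

theorem count_le {n : ℕ} (x : Fin n → 𝒳) (A : Set 𝒳) : count x A ≤ n := by
  classical
  simpa [count] using Finset.card_filter_le (Finset.univ : Finset (Fin n)) fun i => x i ∈ A

theorem empirical_eq_count {n : ℕ} (x : Fin n → 𝒳) (A : Set 𝒳) :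
    empirical x A = (n : ℝ)⁻¹ * count x A := by
  classical
  simp [empirical, count, Set.indicator_apply]

theorem count_eq_zero_iff {n : ℕ} (x : Fin n → 𝒳) (A : Set 𝒳) :
    count x A = 0 ↔ ∀ i, x i ∉ A := by
  simp [count, Finset.filter_eq_empty_iff]

variable [MeasurableSpace 𝒳] [MeasurableSpace Ω] {P : Measure Ω} {Q : Measure 𝒳}

theorem measurable_count {n : ℕ} {X : Fin n → Ω → 𝒳} (hX : ∀ i, Measurable (X i)) {A : Set 𝒳}
    (hA : MeasurableSet A) : Measurable fun ω => count (fun i => X i ω) A := by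
  classical
  simp only [count, Finset.card_filter]
  exact Finset.measurable_sum _ fun i _ =>
    Measurable.ite (hX i hA) measurable_const measurable_const

theorem ae_count_eq_zero {n : ℕ} {X : Fin n → Ω → 𝒳} (hX : ∀ i, Measurable (X i))
    (hlaw : ∀ i, P.map (X i) = Q) {A : Set 𝒳} (hA : MeasurableSet A) (h0 : Q A = 0) :
    ∀ᵐ ω ∂P, count (fun i => X i ω) A = 0 := by
  simp only [count_eq_zero_iff]
  rw [ae_all_iff]
  intro i
  rw [ae_iff]
  simp only [not_not]
  change P (X i ⁻¹' A) = 0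
  rw [← Measure.map_apply (hX i) hA, hlaw i, h0]

variable [Fintype ι]

/-- The generating function of multinomial counts. -/
theorem lintegral_prod_pow_count {n : ℕ} {X : Fin n → Ω → 𝒳} (hX : ∀ i, Measurable (X i))
    (hindep : iIndepFun X P) (hlaw : ∀ i, P.map (X i) = Q) {B : ι → Set 𝒳}
    (hB : ∀ b, MeasurableSet (B b)) (hpart : ∀ x, ∃! b, x ∈ B b) (r : ι → ℝ≥0∞) :
    ∫⁻ ω, ∏ b, r b ^ count (fun i => X i ω) (B b) ∂P = (∑ b, Q (B b) * r b) ^ n := by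
  classical
  set g : 𝒳 → ℝ≥0∞ := fun x => ∑ b, (B b).indicator (fun _ => r b) x with hg
  have hgm : Measurable g :=
    Finset.measurable_sum _ fun b _ => measurable_const.indicator (hB b)
  -- Regrouping by sample points makes the product one of independent factors.
  have hprod : ∀ x : Fin n → 𝒳, ∏ b, r b ^ count x (B b) = ∏ i, g (x i) := by
    intro x
    have : ∀ b, r b ^ count x (B b) = ∏ i, if x i ∈ B b then r b else 1 := by
      intro b
      rw [← Finset.prod_filter, Finset.prod_const, count]
    simp only [this]
    rw [Finset.prod_comm]
    refine Finset.prod_congr rfl fun i _ => ?_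
    obtain ⟨b, hb, huniq⟩ := hpart (x i)
    rw [Finset.prod_eq_single b, hg]
    · simp only
      rw [Finset.sum_eq_single b, Set.indicator_of_mem hb, if_pos hb]
      · exact fun c _ hc => Set.indicator_of_notMem (fun h => hc (huniq c h)) _
      · simp
    · exact fun c _ hc => if_neg fun h => hc (huniq c h)
    · simp
  simp only [hprod]
  rw [lintegral_prod_eq_prod_lintegral_of_indepFun Finset.univ (fun i ω => g (X i ω))
    (hindep.comp (fun _ => g) fun _ => hgm) fun i => hgm.comp (hX i)]
  have : ∀ i, ∫⁻ ω, g (X i ω) ∂P = ∑ b, Q (B b) * r b := by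
    intro i
    rw [← lintegral_map hgm (hX i), hlaw i, hg, lintegral_finsetSum]
    · refine Finset.sum_congr rfl fun b _ => ?_
      rw [lintegral_indicator_const (hB b), mul_comm]
    · exact fun b _ => measurable_const.indicator (hB b)
  simp [this]

/-- Independent Poisson counts would give equality. For multinomial counts the generating function
is (1 + T)ⁿ, which is at most exp(nT). -/
theorem lintegral_prod_exp_mul_pow_count_le [IsProbabilityMeasure Q] {n : ℕ} {X : Fin n → Ω → 𝒳}
    (hX : ∀ i, Measurable (X i)) (hindep : iIndepFun X P) (hlaw : ∀ i, P.map (X i) = Q)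
    {B : ι → Set 𝒳} (hB : ∀ b, MeasurableSet (B b)) (hpart : ∀ x, ∃! b, x ∈ B b) {r : ι → ℝ}
    (hr : ∀ b, 0 ≤ r b) :
    ∫⁻ ω, ENNReal.ofReal (∏ b, (Real.exp (-(n * Q.real (B b) * (r b - 1))) *
      r b ^ count (fun i => X i ω) (B b))) ∂P ≤ 1 := by
  have hsum : ∑ b, Q.real (B b) = 1 := by
    rw [← measureReal_iUnion_fintype]
    · rw [Set.iUnion_eq_univ_iff.2 fun x => (hpart x).exists]; simp
    · intro b c hbc
      exact Set.disjoint_left.2 fun x hx hx' => hbc ((hpart x).unique hx hx')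
    · exact hB
  set T := ∑ b, Q.real (B b) * (r b - 1) with hT
  have h1 : ∀ ω, ENNReal.ofReal (∏ b, (Real.exp (-(n * Q.real (B b) * (r b - 1))) *
      r b ^ count (fun i => X i ω) (B b))) = ENNReal.ofReal (Real.exp (-(n * T))) *
      ∏ b, ENNReal.ofReal (r b) ^ count (fun i => X i ω) (B b) := by
    intro ω
    rw [Finset.prod_mul_distrib, ENNReal.ofReal_mul (Finset.prod_nonneg fun b _ =>
      (Real.exp_pos _).le), ← Real.exp_sum, ENNReal.ofReal_prod_of_nonneg fun b _ =>
      pow_nonneg (hr b) _]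
    congr 2
    · rw [hT, Finset.mul_sum, ← Finset.sum_neg_distrib]
      congr 1
      exact Finset.sum_congr rfl fun b _ => by ring
    · ext b; exact ENNReal.ofReal_pow (hr b) _
  simp only [h1]
  rw [lintegral_const_mul' _ _ ENNReal.ofReal_ne_top,
    lintegral_prod_pow_count hX hindep hlaw hB hpart]
  have h2 : ∑ b, Q (B b) * ENNReal.ofReal (r b) = ENNReal.ofReal (1 + T) := by
    have : 1 + T = ∑ b, Q.real (B b) * r b := by
      rw [hT]
      nth_rewrite 1 [← hsum]
      rw [← Finset.sum_add_distrib]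
      exact Finset.sum_congr rfl fun b _ => by ring
    rw [this, ENNReal.ofReal_sum_of_nonneg fun b _ => mul_nonneg measureReal_nonneg (hr b)]
    refine Finset.sum_congr rfl fun b _ => ?_
    rw [ENNReal.ofReal_mul measureReal_nonneg, ofReal_measureReal]
  rw [h2]
  calc ENNReal.ofReal (Real.exp (-(n * T))) * ENNReal.ofReal (1 + T) ^ n
      ≤ ENNReal.ofReal (Real.exp (-(n * T))) * ENNReal.ofReal (Real.exp T) ^ n := by
        gcongr
        linarith [Real.add_one_le_exp T]
    _ = 1 := by
        rw [← ENNReal.ofReal_pow (Real.exp_pos _).le, ← ENNReal.ofReal_mul (Real.exp_pos _).le,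
          ← Real.exp_nat_mul, ← Real.exp_add]
        simp

/-- Dominating each block by a sum over integer shifts and expanding the product leaves a mixture of
likelihood ratios of expectation at most 1. The total weight per block is at most 2 · 3 = 6 ≤ e². -/
theorem lintegral_exp_sum_sq_sqrt_count_le [IsProbabilityMeasure Q] {n : ℕ}
    {X : Fin n → Ω → 𝒳}
    (hX : ∀ i, Measurable (X i)) (hindep : iIndepFun X P) (hlaw : ∀ i, P.map (X i) = Q)
    {B : ι → Set 𝒳} (hB : ∀ b, MeasurableSet (B b)) (hpart : ∀ x, ∃! b, x ∈ B b) :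
    ∫⁻ ω, ENNReal.ofReal (Real.exp (∑ b,
      (√(count (fun i => X i ω) (B b)) - √(n * Q.real (B b))) ^ 2 / 4)) ∂P ≤
      ENNReal.ofReal (Real.exp (2 * Fintype.card ι)) := by
  classical
  set l : ι → ℝ := fun b => √(n * Q.real (B b)) with hl
  have hlsq : ∀ b, l b ^ 2 = n * Q.real (B b) := fun b =>
    Real.sq_sqrt (mul_nonneg (Nat.cast_nonneg n) measureReal_nonneg)
  -- On a block with l = 0 the count vanishes almost surely, and the ratio 1 makes `F` trivial.
  set r : ι → ℤ → ℝ := fun b j => if l b = 0 then 1 else ((l b + j) / l b) ^ 2 with hr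
  have hr0 : ∀ b j, 0 ≤ r b j := by
    intro b j; simp only [hr]; split_ifs <;> positivity
  set F : ι → ℤ → ℕ → ℝ := fun b j k =>
    Real.exp (-(n * Q.real (B b) * (r b j - 1))) * r b j ^ k with hF
  have hF0 : ∀ b j k, 0 ≤ F b j k := fun b j k =>
    mul_nonneg (Real.exp_pos _).le (pow_nonneg (hr0 b j) k)
  set J := Finset.Icc (-(n : ℤ)) n with hJ
  have hblock : ∀ b k, k ≤ n → (l b = 0 → k = 0) → Real.exp ((√(k : ℕ) - l b) ^ 2 / 4) ≤
      ∑ j ∈ J, 2 * (1 / 2) ^ j.natAbs * F b j k := by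
    intro b k hkn hk0
    have hterm : ∃ j ∈ J, Real.exp ((√(k : ℕ) - l b) ^ 2 / 4) ≤
        2 * (1 / 2) ^ j.natAbs * F b j k := by
      by_cases h0 : l b = 0
      · refine ⟨0, by simp [hJ], ?_⟩
        simp [hF, hr, h0, hk0 h0]
      · have hlpos : 0 < l b := lt_of_le_of_ne (Real.sqrt_nonneg _) (Ne.symm h0)
        have hle : l b ^ 2 ≤ n := by
          rw [hlsq]
          exact mul_le_of_le_one_right (Nat.cast_nonneg n) measureReal_le_one
        obtain ⟨j, hj, h⟩ := exists_exp_sq_sqrt_sub_le hlpos hkn hle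
        refine ⟨j, hj, h.trans (le_of_eq ?_)⟩
        simp only [hF, hr, if_neg h0]
        rw [← hlsq]
        congr 4
        field_simp
    obtain ⟨j, hj, h⟩ := hterm
    exact h.trans (Finset.single_le_sum (f := fun j => 2 * (1 / 2) ^ j.natAbs * F b j k)
      (fun i _ => mul_nonneg (by positivity) (hF0 b i k)) hj)
  have hae : ∀ᵐ ω ∂P, ∀ b, l b = 0 → count (fun i => X i ω) (B b) = 0 := by
    rw [ae_all_iff]
    intro b
    by_cases h0 : l b = 0
    · rcases Nat.eq_zero_or_pos n with rfl | hn
      · exact ae_of_all _ fun ω _ => Nat.le_zero.1 (count_le _ _)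
      have hq : Q (B b) = 0 := by
        have h1 := hlsq b
        rw [h0] at h1
        have hn' : (n : ℝ) ≠ 0 := by positivity
        have h2 : Q.real (B b) = 0 := by
          rcases mul_eq_zero.1 (h1.symm.trans (by norm_num)) with h | h
          · exact absurd h hn'
          · exact h
        exact (measureReal_eq_zero_iff (measure_ne_top _ _)).1 h2
      filter_upwards [ae_count_eq_zero hX hlaw (hB b) hq] with ω hω _ using hω
    · exact ae_of_all _ fun ω h => absurd h h0
  have hpt : ∀ᵐ ω ∂P, ENNReal.ofReal (Real.exp (∑ b,
      (√(count (fun i => X i ω) (B b)) - l b) ^ 2 / 4)) ≤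
      -- Each φ chooses one integer shift per block.
      ∑ φ ∈ Fintype.piFinset fun _ : ι => J,
        ENNReal.ofReal (∏ b, 2 * (1 / 2) ^ (φ b).natAbs) *
        ENNReal.ofReal (∏ b, F b (φ b) (count (fun i => X i ω) (B b))) := by
    filter_upwards [hae] with ω hω
    rw [Real.exp_sum]
    have h1 : ∏ b, Real.exp ((√(count (fun i => X i ω) (B b)) - l b) ^ 2 / 4) ≤
        ∏ b, ∑ j ∈ J, 2 * (1 / 2) ^ j.natAbs * F b j (count (fun i => X i ω) (B b)) :=
      Finset.prod_le_prod (fun b _ => (Real.exp_pos _).le) fun b _ =>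
        hblock b _ (count_le _ _) (hω b)
    refine (ENNReal.ofReal_le_ofReal h1).trans (le_of_eq ?_)
    rw [Finset.prod_univ_sum, ENNReal.ofReal_sum_of_nonneg fun φ _ => Finset.prod_nonneg
      fun b _ => mul_nonneg (by positivity) (hF0 b _ _)]
    refine Finset.sum_congr rfl fun φ _ => ?_
    rw [Finset.prod_mul_distrib, ENNReal.ofReal_mul (by positivity)]
  have hFm : ∀ φ : ι → ℤ, Measurable fun ω =>
      ENNReal.ofReal (∏ b, F b (φ b) (count (fun i => X i ω) (B b))) := by
    intro φ
    refine (Finset.measurable_prod _ fun b _ => ?_).ennreal_ofReal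
    exact (measurable_from_nat (f := F b (φ b))).comp (measurable_count hX (hB b))
  refine (lintegral_mono_ae hpt).trans ?_
  rw [lintegral_finsetSum _ fun φ _ => (hFm φ).const_mul _]
  calc ∑ φ ∈ Fintype.piFinset fun _ : ι => J, ∫⁻ ω,
        ENNReal.ofReal (∏ b, 2 * (1 / 2) ^ (φ b).natAbs) *
        ENNReal.ofReal (∏ b, F b (φ b) (count (fun i => X i ω) (B b))) ∂P
      ≤ ∑ φ ∈ Fintype.piFinset fun _ : ι => J,
        ENNReal.ofReal (∏ b, 2 * (1 / 2) ^ (φ b).natAbs) := by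
        refine Finset.sum_le_sum fun φ _ => ?_
        rw [lintegral_const_mul' _ _ ENNReal.ofReal_ne_top]
        exact mul_le_of_le_one_right' (lintegral_prod_exp_mul_pow_count_le hX hindep hlaw hB
          hpart fun b => hr0 b (φ b))
    _ = ENNReal.ofReal ((2 * ∑ j ∈ J, (1 / 2) ^ j.natAbs) ^ Fintype.card ι) := by
        rw [← ENNReal.ofReal_sum_of_nonneg fun φ _ => by positivity,
          ← Finset.prod_univ_sum (fun _ => J) fun _ j => (2 : ℝ) * (1 / 2) ^ j.natAbs]
        simp [Finset.mul_sum]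
    _ ≤ ENNReal.ofReal (Real.exp (2 * Fintype.card ι)) := by
        refine ENNReal.ofReal_le_ofReal ?_
        rw [mul_comm (2 : ℝ) (Fintype.card ι : ℝ), Real.exp_nat_mul]
        refine pow_le_pow_left₀ (by positivity) ?_ _
        have h6 : (6 : ℝ) ≤ Real.exp 2 := by
          have := Real.exp_one_gt_d9
          rw [show (2 : ℝ) = 1 + 1 by norm_num, Real.exp_add]
          nlinarith
        linarith [sum_Icc_half_pow_natAbs_le n]

/-- Exponential moment of the squared Hellinger distance between the empirical distribution and
the true one on a partition. -/
theorem lintegral_exp_sum_sq_sqrt_empirical_le [IsProbabilityMeasure Q] {n : ℕ} (hn : 1 ≤ n)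
    {X : Fin n → Ω → 𝒳}
    (hX : ∀ i, Measurable (X i)) (hindep : iIndepFun X P) (hlaw : ∀ i, P.map (X i) = Q)
    {m : Part 𝒳} (hm : ∀ I ∈ m.parts, MeasurableSet I) :
    ∫⁻ ω, ENNReal.ofReal (Real.exp (n / 4 *
      ∑ I ∈ m.parts, (√(empirical (fun i => X i ω) I) - √(Q.real I)) ^ 2)) ∂P ≤
      ENNReal.ofReal (Real.exp (2 * m.parts.card)) := by
  have hpart : ∀ x, ∃! b : m.parts, x ∈ (b : Set 𝒳) := by
    intro x
    obtain ⟨I, hI, hx⟩ := exists_mem_part m x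
    exact ⟨⟨I, hI⟩, hx, fun J hJ => Subtype.ext (part_eq_of_mem m J.2 hI hJ hx)⟩
  have h := lintegral_exp_sum_sq_sqrt_count_le hX hindep hlaw
    (B := fun b : m.parts => (b : Set 𝒳)) (fun b => hm b b.2) hpart
  rw [Fintype.card_coe] at h
  refine le_of_eq_of_le (lintegral_congr fun ω => ?_) h
  congr 2
  rw [Finset.sum_coe_sort m.parts (fun I : Set 𝒳 =>
    (√(count (fun i => X i ω) I : ℝ) - √(n * Q.real I)) ^ 2 / 4), Finset.mul_sum]
  refine Finset.sum_congr rfl fun I _ => ?_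
  have hn0 : (0 : ℝ) < n := by positivity
  rw [empirical_eq_count, Real.sqrt_mul (by positivity), Real.sqrt_inv,
    Real.sqrt_mul (Nat.cast_nonneg n)]
  have hs := Real.sq_sqrt hn0.le
  have hs0 := Real.sqrt_pos.2 hn0
  have : √(count (fun i => X i ω) I : ℝ) = √n * ((√n)⁻¹ * √(count (fun i => X i ω) I : ℝ)) := by
    field_simp
  nth_rewrite 2 [this]
  rw [← mul_sub, mul_pow, hs]
  ring

end Multinomial

/-! ### Tests, selection and the deterministic oracle bound -/

section Selection

variable {𝒳 : Type*} [MeasurableSpace 𝒳] {μ : Measure 𝒳} {n : ℕ} {x : Fin n → 𝒳} {s : 𝒳 → ℝ}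
  {pen : Part 𝒳 → ℝ}

theorem hellSq_hist_hist_ne_top (hn : 1 ≤ n) (x : Fin n → 𝒳) (m m' : Part 𝒳) :
    hellSq μ (hist μ x m) (hist μ x m') ≠ ∞ := by
  obtain ⟨hm, h0, -⟩ := hist_mem_cone (μ := μ) x m
  have h := (hellSq_le_lintegral_add (μ := μ) hm h0 (hist_mem_cone (μ := μ) x m').2.1).trans
    (add_le_add (lintegral_hist_le hn x m) (lintegral_hist_le hn x m'))
  exact ne_top_of_le_ne_top (by norm_num) h

theorem testStat_swap (μ : Measure 𝒳) (x : Fin n → 𝒳) (pen : Part 𝒳 → ℝ) (m m' : Part 𝒳) :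
    testStat μ x pen m' m = -testStat μ x pen m m' := by
  simp only [testStat, join_comm m' m]
  ring

/-- The statistic is antisymmetric in the two partitions, and the tie-break decides the value zero.
-/
theorem mem_rejecting_or_mem_rejecting {𝓜 : Set (Part 𝒳)} {τ : Part 𝒳 → Part 𝒳 → Prop}
    (hτ : IsTieBreak τ) {m m' : Part 𝒳} (hm : m ∈ 𝓜) (hm' : m' ∈ 𝓜) (hne : m ≠ m') :
    m' ∈ rejecting μ x 𝓜 pen τ m ∨ m ∈ rejecting μ x 𝓜 pen τ m' := by
  simp only [rejecting, Set.mem_ofPred_eq, testStat_swap μ x pen m m']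
  rcases lt_trichotomy (testStat μ x pen m m') 0 with h | h | h
  · exact Or.inr ⟨hm, hne, Or.inl (by linarith)⟩
  · by_cases ht : τ m m'
    · exact Or.inl ⟨hm', hne.symm, Or.inr ⟨h, ht⟩⟩
    · refine Or.inr ⟨hm, hne, Or.inr ⟨by linarith, ?_⟩⟩
      by_contra h'
      exact ht ((hτ m m' hne).2 h')
  · exact Or.inl ⟨hm', hne.symm, Or.inl h⟩

theorem hellSq_hist_join_le {m m' : Part 𝒳}
    (hm : ∀ I ∈ m.parts, MeasurableSet I) (hm' : ∀ I ∈ m'.parts, MeasurableSet I)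
    (hnull : ∀ J ∈ (join m m').parts, μ J = 0 → empirical x J = 0) (hs : s ∈ cone μ)
    {t : 𝒳 → ℝ} (ht : t ∈ model μ m) :
    hellSq μ (hist μ x m) (hist μ x (join m m')) ≤
      8 * hellSq μ (hist μ x (join m m')) (blockMean μ s (join m m')) + 8 * hellSq μ s t := by
  have hmeas := measurableSet_of_mem_join hm hm'
  have hstep := isStep_of_mem_model ht
  have htm : Measurable t := ht.2.1
  have hkm : Measurable (hist μ x (join m m')) := measurable_piecewise _ _ _
  calc hellSq μ (hist μ x m) (hist μ x (join m m'))
      ≤ 2 * hellSq μ (hist μ x m) t + 2 * hellSq μ t (hist μ x (join m m')) :=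
        hellSq_le_two_add_two (measurable_piecewise _ _ _) htm
    _ ≤ 2 * hellSq μ (hist μ x (join m m')) t + 2 * hellSq μ (hist μ x (join m m')) t := by
        rw [hellSq_comm t]
        gcongr
        exact hellSq_hist_le_hellSq_hist_join x hm hmeas hnull hstep
    _ = 4 * hellSq μ (hist μ x (join m m')) t := by rw [← add_mul]; norm_num
    _ ≤ 4 * (2 * hellSq μ (hist μ x (join m m')) (blockMean μ s (join m m')) +
          2 * hellSq μ (blockMean μ s (join m m')) t) := by
        gcongr
        exact hellSq_le_two_add_two hkm (measurable_blockMean _ _)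
    _ ≤ 4 * (2 * hellSq μ (hist μ x (join m m')) (blockMean μ s (join m m')) +
          2 * hellSq μ s t) := by
        gcongr
        exact hellSq_blockMean_le hmeas hs hstep.join
    _ = _ := by rw [mul_add, ← mul_assoc, ← mul_assoc]; norm_num

/-- If the test between `m` and `m'` does not favour `m`, then the histograms based on `m` and `m'`
are close, up to the quality of the model `m`. -/
theorem hellSq_hist_le_of_testStat_nonneg (hn : 1 ≤ n) {m m' : Part 𝒳}
    (hm : ∀ I ∈ m.parts, MeasurableSet I) (hm' : ∀ I ∈ m'.parts, MeasurableSet I)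
    (hnull : ∀ J ∈ (join m m').parts, μ J = 0 → empirical x J = 0) (hs : s ∈ cone μ)
    {g : ℝ≥0∞} (hpen : 0 ≤ pen m) (hpen' : 0 ≤ pen m')
    (hg : hellSq μ (hist μ x (join m m')) (blockMean μ s (join m m')) ≤
      ENNReal.ofReal (pen m + pen m') + g) (hT : 0 ≤ testStat μ x pen m m')
    {t : 𝒳 → ℝ} (ht : t ∈ model μ m) :
    hellSq μ (hist μ x m) (hist μ x m') ≤
      64 * ENNReal.ofReal (pen m) + 32 * g + 32 * hellSq μ s t := by
  have h1 := hellSq_hist_join_le hm hm' hnull hs ht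
  have hk : Measurable (hist μ x (join m m')) := measurable_piecewise _ _ _
  have h2 : hellSq μ (hist μ x m) (hist μ x m') ≤ 2 * hellSq μ (hist μ x m) (hist μ x (join m m'))
      + 2 * hellSq μ (hist μ x m') (hist μ x (join m m')) := by
    rw [hellSq_comm (hist μ x m') (hist μ x (join m m'))]
    exact hellSq_le_two_add_two (measurable_piecewise _ _ _) hk
  have f0 := hellSq_hist_hist_ne_top (μ := μ) hn x m m'
  have f1 := hellSq_hist_hist_ne_top (μ := μ) hn x m (join m m')
  have f2 := hellSq_hist_hist_ne_top (μ := μ) hn x m' (join m m')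
  rw [testStat] at hT
  -- Infinite right-hand sides are trivial. Once they are excluded every quantity is finite and the
  -- claim is linear arithmetic.
  rcases eq_or_ne g ∞ with rfl | hgt
  · simp
  rcases eq_or_ne (hellSq μ s t) ∞ with hst | hst
  · simp [hst]
  have f3 : hellSq μ (hist μ x (join m m')) (blockMean μ s (join m m')) ≠ ∞ :=
    ne_top_of_le_ne_top (by finiteness) hg
  lift g to NNReal using hgt
  generalize hellSq μ (hist μ x m) (hist μ x m') = a at *
  generalize hellSq μ (hist μ x m) (hist μ x (join m m')) = b at *
  generalize hellSq μ (hist μ x m') (hist μ x (join m m')) = c at *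
  generalize hellSq μ (hist μ x (join m m')) (blockMean μ s (join m m')) = e at *
  generalize hellSq μ s t = d at *
  lift a to NNReal using f0
  lift b to NNReal using f1
  lift c to NNReal using f2
  lift d to NNReal using hst
  lift e to NNReal using f3
  have e1 : ENNReal.ofReal (pen m) = ((pen m).toNNReal : ℝ≥0∞) := rfl
  have e2 : ENNReal.ofReal (pen m + pen m') = ((pen m + pen m').toNNReal : ℝ≥0∞) := rfl
  rw [e2] at hg
  rw [e1]
  simp only [ENNReal.coe_toReal] at hT
  norm_cast at *
  rw [← NNReal.coe_le_coe] at *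
  push_cast [Real.coe_toNNReal _ hpen, Real.coe_toNNReal _ (add_nonneg hpen hpen')] at *
  -- With a, b, c, d, e as generalized above: a ≤ 2b + 2c ≤ 4b + 32(pen m - pen m'), and 4b ≤ 32e +
  -- 32d with e ≤ pen m + pen m' + g, so that pen m' cancels.
  linarith

/-- Deterministic oracle bound for the selected histogram. -/
theorem hellSq_hist_selected_le (hn : 1 ≤ n) {𝓜 : Set (Part 𝒳)}
    (h𝓜 : ∀ m ∈ 𝓜, ∀ I ∈ m.parts, MeasurableSet I)
    (hnull : ∀ m ∈ 𝓜, ∀ m' ∈ 𝓜, ∀ J ∈ (join m m').parts, μ J = 0 → empirical x J = 0)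
    (hs : s ∈ cone μ) {g : ℝ≥0∞} (hpen : ∀ m ∈ 𝓜, 0 ≤ pen m)
    (hg : ∀ m ∈ 𝓜, ∀ m' ∈ 𝓜, hellSq μ (hist μ x (join m m')) (blockMean μ s (join m m')) ≤
      ENNReal.ofReal (pen m + pen m') + g) {τ : Part 𝒳 → Part 𝒳 → Prop} (hτ : IsTieBreak τ)
    {ε : ℝ} {m' : Part 𝒳} (hm' : IsSelected μ x 𝓜 pen τ ε m') {m : Part 𝒳} (hm : m ∈ 𝓜)
    {t : 𝒳 → ℝ} (ht : t ∈ model μ m) :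
    hellSq μ (hist μ x m') s ≤
      200 * ENNReal.ofReal (pen m) + 100 * g + 112 * hellSq μ s t + ENNReal.ofReal ε := by
  have hcrit : crit μ x 𝓜 pen τ m ≤
      64 * ENNReal.ofReal (pen m) + 32 * g + 32 * hellSq μ s t := by
    refine iSup₂_le fun k hk => ?_
    obtain ⟨hk𝓜, -, hT⟩ := hk
    refine hellSq_hist_le_of_testStat_nonneg hn (h𝓜 m hm) (h𝓜 k hk𝓜) (hnull m hm k hk𝓜) hs
      (hpen m hm) (hpen k hk𝓜) (hg m hm k hk𝓜) ?_ ht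
    rcases hT with h | h
    · exact h.le
    · exact h.1.ge
  have hcrit' : crit μ x 𝓜 pen τ m' ≤ crit μ x 𝓜 pen τ m + ENNReal.ofReal (ε / 3) :=
    hm'.2.trans (by gcongr; exact iInf₂_le m hm)
  have hdist : hellSq μ (hist μ x m') (hist μ x m) ≤
      crit μ x 𝓜 pen τ m + ENNReal.ofReal (ε / 3) := by
    by_cases hne : m = m'
    · rw [hne, hellSq_self]; exact zero_le
    rcases mem_rejecting_or_mem_rejecting (μ := μ) (x := x) (pen := pen) hτ hm hm'.1 hne with h | h
    · rw [hellSq_comm]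
      exact (le_iSup₂ (f := fun k _ => hellSq μ (hist μ x m) (hist μ x k)) m' h).trans
        le_self_add
    · exact (le_iSup₂ (f := fun k _ => hellSq μ (hist μ x m') (hist μ x k)) m h).trans hcrit'
  have hself : hellSq μ (hist μ x m) s ≤
      4 * ENNReal.ofReal (pen m) + 2 * g + 8 * hellSq μ s t := by
    -- The pair (m, m) controls the deviation on m itself.
    have h1 := hg m hm m hm
    rw [join_self, ENNReal.ofReal_add (hpen m hm) (hpen m hm)] at h1
    calc hellSq μ (hist μ x m) s
        ≤ 2 * hellSq μ (hist μ x m) (blockMean μ s m) + 2 * hellSq μ (blockMean μ s m) s :=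
          hellSq_le_two_add_two (measurable_piecewise _ _ _) (measurable_blockMean _ _)
      _ ≤ 2 * hellSq μ (hist μ x m) (blockMean μ s m) +
            2 * (2 * hellSq μ (blockMean μ s m) t + 2 * hellSq μ t s) := by
          gcongr
          exact hellSq_le_two_add_two (measurable_blockMean _ _) ht.2.1
      _ ≤ 2 * (ENNReal.ofReal (pen m) + ENNReal.ofReal (pen m) + g) +
            2 * (2 * hellSq μ s t + 2 * hellSq μ s t) := by
          rw [hellSq_comm t s]
          gcongr
          exact hellSq_blockMean_le (h𝓜 m hm) hs (isStep_of_mem_model ht)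
      _ = _ := by ring
  calc hellSq μ (hist μ x m') s
      ≤ 3 * hellSq μ (hist μ x m') (hist μ x m) + 2 * hellSq μ (hist μ x m) s :=
        hellSq_le_three_add_two (measurable_piecewise _ _ _) (measurable_piecewise _ _ _)
    _ ≤ 3 * (64 * ENNReal.ofReal (pen m) + 32 * g + 32 * hellSq μ s t + ENNReal.ofReal (ε / 3)) +
          2 * (4 * ENNReal.ofReal (pen m) + 2 * g + 8 * hellSq μ s t) := by
        gcongr
        exact hdist.trans (by gcongr)
    _ = 200 * ENNReal.ofReal (pen m) + 100 * g + 112 * hellSq μ s t +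
          3 * ENNReal.ofReal (ε / 3) := by ring
    _ = _ := by
        congr 1
        rw [← ENNReal.ofReal_ofNat 3, ← ENNReal.ofReal_mul (by norm_num)]
        congr 1
        ring

end Selection

/-! ### Uniform deviation bound over pairs of partitions -/

section Deviation

variable {𝒳 Ω : Type*} [MeasurableSpace 𝒳] [MeasurableSpace Ω] {P : Measure Ω} {Q : Measure 𝒳}

/-- Squared Hellinger distance between the empirical distribution and `Q` on the blocks of `m`. -/
noncomputable def empiricalDev (Q : Measure 𝒳) {n : ℕ} (x : Fin n → 𝒳) (m : Part 𝒳) : ℝ :=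
  ∑ I ∈ m.parts, (√(empirical x I) - √(Q.real I)) ^ 2

/-- Weighted sum, over the pairs of partitions, of the exponentials of the deviations of the
empirical distribution. -/
noncomputable def devSum (Q : Measure 𝒳) {n : ℕ} (x : Fin n → 𝒳) (𝓜 : Set (Part 𝒳))
    (Δ : Part 𝒳 → ℝ) : ℝ≥0∞ :=
  ∑' p : 𝓜 × 𝓜, ENNReal.ofReal (Real.exp (n / 4 * empiricalDev Q x (join p.1.1 p.2.1) -
    2 * (join p.1.1 p.2.1).parts.card - Δ p.1 - Δ p.2))

theorem measurable_empiricalDev {n : ℕ} {X : Fin n → Ω → 𝒳} (hX : ∀ i, Measurable (X i))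
    {m : Part 𝒳} (hm : ∀ I ∈ m.parts, MeasurableSet I) :
    Measurable fun ω => empiricalDev Q (fun i => X i ω) m := by
  refine Finset.measurable_sum _ fun I hI => ?_
  have h : Measurable fun ω => empirical (fun i => X i ω) I :=
    (Finset.measurable_sum _ fun i _ =>
      (measurable_const.indicator (hm I hI)).comp (hX i)).const_mul _
  fun_prop

theorem lintegral_devSum_le [IsProbabilityMeasure Q] {n : ℕ} (hn : 1 ≤ n)
    {X : Fin n → Ω → 𝒳} (hX : ∀ i, Measurable (X i)) (hindep : iIndepFun X P)
    (hlaw : ∀ i, P.map (X i) = Q) {𝓜 : Set (Part 𝒳)} (hcount : 𝓜.Countable)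
    (h𝓜 : ∀ m ∈ 𝓜, ∀ I ∈ m.parts, MeasurableSet I) {Δ : Part 𝒳 → ℝ} {S : ℝ}
    (hS : HasSum (fun m : 𝓜 => Real.exp (-Δ m)) S) :
    ∫⁻ ω, devSum Q (fun i => X i ω) 𝓜 Δ ∂P ≤ ENNReal.ofReal (S ^ 2) := by
  have : Countable 𝓜 := hcount.to_subtype
  have hmeas : ∀ p : 𝓜 × 𝓜, ∀ J ∈ (join p.1.1 p.2.1).parts, MeasurableSet J := fun p =>
    measurableSet_of_mem_join (h𝓜 _ p.1.2) (h𝓜 _ p.2.2)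
  simp only [devSum]
  rw [lintegral_tsum fun p => by
    have := measurable_empiricalDev (Q := Q) hX (hmeas p)
    exact Measurable.aemeasurable (by fun_prop)]
  have hterm : ∀ p : 𝓜 × 𝓜, ∫⁻ ω, ENNReal.ofReal (Real.exp (n / 4 *
      empiricalDev Q (fun i => X i ω) (join p.1.1 p.2.1) -
      2 * (join p.1.1 p.2.1).parts.card - Δ p.1 - Δ p.2)) ∂P ≤
      ENNReal.ofReal (Real.exp (-Δ p.1)) * ENNReal.ofReal (Real.exp (-Δ p.2)) := by
    intro p
    set N : ℝ := ((join p.1.1 p.2.1).parts.card : ℝ)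
    have h1 : ∀ ω, ENNReal.ofReal (Real.exp (n / 4 *
        empiricalDev Q (fun i => X i ω) (join p.1.1 p.2.1) - 2 * N - Δ p.1 - Δ p.2)) =
        ENNReal.ofReal (Real.exp (-(2 * N) - Δ p.1 - Δ p.2)) * ENNReal.ofReal (Real.exp (n / 4 *
        empiricalDev Q (fun i => X i ω) (join p.1.1 p.2.1))) := by
      intro ω
      rw [← ENNReal.ofReal_mul (Real.exp_pos _).le, ← Real.exp_add]
      congr 2
      ring
    simp only [h1]
    rw [lintegral_const_mul' _ _ ENNReal.ofReal_ne_top]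
    refine (mul_le_mul_right (lintegral_exp_sum_sq_sqrt_empirical_le hn hX hindep hlaw
      (hmeas p)) _).trans (le_of_eq ?_)
    rw [← ENNReal.ofReal_mul (Real.exp_pos _).le, ← ENNReal.ofReal_mul (Real.exp_pos _).le,
      ← Real.exp_add, ← Real.exp_add]
    congr 2
    ring
  refine (ENNReal.tsum_le_tsum hterm).trans (le_of_eq ?_)
  rw [ENNReal.tsum_prod (f := fun a b : 𝓜 =>
    ENNReal.ofReal (Real.exp (-Δ a)) * ENNReal.ofReal (Real.exp (-Δ b)))]
  simp only [ENNReal.tsum_mul_left, ENNReal.tsum_mul_right]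
  rw [← ENNReal.ofReal_tsum_of_nonneg (fun _ => (Real.exp_pos _).le) hS.summable, hS.tsum_eq,
    ← pow_two, ← ENNReal.ofReal_pow (hS.nonneg fun _ => (Real.exp_pos _).le)]

/-- A single term exp(y) is at most the whole sum, and y ≤ exp(y) converts this into an additive
error. It replaces a union bound and the integration of tails. -/
theorem ofReal_empiricalDev_join_le {n : ℕ} (hn : 1 ≤ n) (x : Fin n → 𝒳) {𝓜 : Set (Part 𝒳)}
    {Δ : Part 𝒳 → ℝ} {m m' : Part 𝒳} (hm : m ∈ 𝓜) (hm' : m' ∈ 𝓜) {a : ℝ} (ha : 0 ≤ a)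
    (hle : 2 * ((join m m').parts.card : ℝ) + Δ m + Δ m' ≤ n / 4 * a) :
    ENNReal.ofReal (empiricalDev Q x (join m m')) ≤
      ENNReal.ofReal a + ENNReal.ofReal (4 / n) * devSum Q x 𝓜 Δ := by
  have hn0 : (0 : ℝ) < n := by positivity
  set y := n / 4 * empiricalDev Q x (join m m') - 2 * (join m m').parts.card - Δ m - Δ m'
    with hy
  have h1 : ENNReal.ofReal (Real.exp y) ≤ devSum Q x 𝓜 Δ :=
    ENNReal.le_tsum (f := fun p : 𝓜 × 𝓜 => ENNReal.ofReal (Real.exp (n / 4 *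
      empiricalDev Q x (join p.1.1 p.2.1) - 2 * (join p.1.1 p.2.1).parts.card - Δ p.1 - Δ p.2)))
      (⟨m, hm⟩, ⟨m', hm'⟩)
  have h2 : empiricalDev Q x (join m m') ≤ a + 4 / n * Real.exp y := by
    have h3 : n / 4 * empiricalDev Q x (join m m') ≤ n / 4 * (a + 4 / n * Real.exp y) := by
      have : n / 4 * (a + 4 / n * Real.exp y) = n / 4 * a + Real.exp y := by field_simp
      rw [this]
      linarith [Real.add_one_le_exp y]
    exact le_of_mul_le_mul_left h3 (by positivity)
  refine (ENNReal.ofReal_le_ofReal h2).trans ?_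
  rw [ENNReal.ofReal_add ha (by positivity), ENNReal.ofReal_mul (by positivity)]
  gcongr

end Deviation

end PHE

/-! ### The risk bound -/

theorem mainTheorem2
    {𝒳 Ω : Type*} [MeasurableSpace 𝒳] [MeasurableSpace Ω]
    (P : Measure Ω) [IsProbabilityMeasure P]
    (μ : Measure 𝒳) [SigmaFinite μ]
    -- the sample with density `s` with respect to `μ`
    (s : 𝒳 → ℝ) (hs_meas : Measurable s) (hs_nonneg : ∀ x, 0 ≤ s x)
    (n : ℕ) (hn : 1 ≤ n)
    (X : Fin n → Ω → 𝒳) (hX_meas : ∀ i, Measurable (X i))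
    (hX_indep : iIndepFun X P)
    (hX_law : ∀ i, P.map (X i) = μ.withDensity (fun x => ENNReal.ofReal (s x)))
    -- the family of finite measurable partitions, with Assumption (H)
    (𝓜 : Set (PHE.Part 𝒳)) (h𝓜_count : 𝓜.Countable)
    (h𝓜_meas : ∀ m ∈ 𝓜, ∀ I ∈ m.parts, MeasurableSet I)
    (δ : ℝ) (hδ : 1 ≤ δ)
    (hH : ∀ m ∈ 𝓜, ∀ m' ∈ 𝓜,
      ((PHE.join m m').parts.card : ℝ) ≤ δ * ((m.parts.card : ℝ) + (m'.parts.card : ℝ)))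
    -- the weights and the penalty
    (Δ : PHE.Part 𝒳 → ℝ) (hΔ_nonneg : ∀ m ∈ 𝓜, 0 ≤ Δ m)
    (S : ℝ) (hS : HasSum (fun m : 𝓜 => Real.exp (-Δ m)) S)
    (pen : PHE.Part 𝒳 → ℝ)
    (hpen : ∀ m ∈ 𝓜, (n : ℝ)⁻¹ * (8 * δ * (m.parts.card : ℝ) + 202 * Δ m) ≤ pen m)
    -- the (possibly random) resolution of ties, and the selected partition
    (ε : ℝ) (hε : 0 < ε)
    (τ : Ω → PHE.Part 𝒳 → PHE.Part 𝒳 → Prop) (hτ : ∀ ω, PHE.IsTieBreak (τ ω))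
    (mhat : Ω → PHE.Part 𝒳) (hmhat_meas : ∀ m ∈ 𝓜, MeasurableSet {ω | mhat ω = m})
    (hmhat : ∀ᵐ ω ∂P, PHE.IsSelected μ (fun i => X i ω) 𝓜 pen (τ ω) ε (mhat ω)) :
    ∫⁻ ω, PHE.hellSq μ (PHE.hist μ (fun i => X i ω) (mhat ω)) s ∂P ≤
      min
        (390 * ((⨅ m ∈ 𝓜, (PHE.hellSqSet μ s (PHE.model μ m) + ENNReal.ofReal (pen m)))
            + ENNReal.ofReal (101 * S ^ 2 / n))
          + ENNReal.ofReal ε)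
        2 := by
  have hn0 : (0 : ℝ) < n := by positivity
  set Q : Measure 𝒳 := μ.withDensity (fun x => ENNReal.ofReal (s x)) with hQ
  have hQprob : IsProbabilityMeasure Q := by
    rw [← hX_law ⟨0, hn⟩]
    exact Measure.isProbabilityMeasure_map (hX_meas _).aemeasurable
  have hs_lint : ∫⁻ x, ENNReal.ofReal (s x) ∂μ = 1 := by
    have := hQprob.measure_univ
    rwa [hQ, withDensity_apply _ MeasurableSet.univ, Measure.restrict_univ] at this
  have hs : s ∈ PHE.cone μ := by
    refine ⟨hs_meas, hs_nonneg, hs_meas.aestronglyMeasurable, ?_⟩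
    rw [hasFiniteIntegral_iff_ofReal (ae_of_all _ hs_nonneg), hs_lint]
    exact ENNReal.one_lt_top
  refine le_min ?_ ?_
  swap
  · calc ∫⁻ ω, PHE.hellSq μ (PHE.hist μ (fun i => X i ω) (mhat ω)) s ∂P
        ≤ ∫⁻ _, 2 ∂P := by
          refine lintegral_mono fun ω => ?_
          obtain ⟨hm, h0, -⟩ := PHE.hist_mem_cone (μ := μ) (fun i => X i ω) (mhat ω)
          refine (PHE.hellSq_le_lintegral_add hm h0 hs_nonneg).trans ?_
          rw [hs_lint, ← one_add_one_eq_two]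
          gcongr
          exact PHE.lintegral_hist_le hn _ _
      _ = 2 := by simp
  have hmeas : ∀ m ∈ 𝓜, ∀ m' ∈ 𝓜, ∀ J ∈ (PHE.join m m').parts, MeasurableSet J :=
    fun m hm m' hm' => PHE.measurableSet_of_mem_join (h𝓜_meas m hm) (h𝓜_meas m' hm')
  have hpen0 : ∀ m ∈ 𝓜, 0 ≤ pen m := fun m hm => by
    have := hΔ_nonneg m hm
    exact le_trans (by positivity) (hpen m hm)
  have hpenle : ∀ m ∈ 𝓜, ∀ m' ∈ 𝓜,
      2 * ((PHE.join m m').parts.card : ℝ) + Δ m + Δ m' ≤ n / 4 * (pen m + pen m') := by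
    intro m hm m' hm'
    have h1 := mul_le_mul_of_nonneg_left (hpen m hm) hn0.le
    have h2 := mul_le_mul_of_nonneg_left (hpen m' hm') hn0.le
    rw [mul_inv_cancel_left₀ hn0.ne'] at h1 h2
    -- One quarter of 8δ|m| is 2δ|m|, which by (H), summed over the pair, pays for 2|m ∨ m'|. One
    -- quarter of 202Δ exceeds Δ.
    linarith [hH m hm m' hm', hΔ_nonneg m hm, hΔ_nonneg m' hm']
  have hnull : ∀ᵐ ω ∂P, ∀ m ∈ 𝓜, ∀ m' ∈ 𝓜, ∀ J ∈ (PHE.join m m').parts, μ J = 0 →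
      PHE.empirical (fun i => X i ω) J = 0 := by
    rw [ae_ball_iff h𝓜_count]; intro m hm
    rw [ae_ball_iff h𝓜_count]; intro m' hm'
    refine (Filter.eventually_all_finset _).2 fun J hJ => ?_
    by_cases h0 : μ J = 0
    · filter_upwards [PHE.ae_count_eq_zero hX_meas hX_law (hmeas m hm m' hm' J hJ)
        (withDensity_absolutelyContinuous μ _ h0)] with ω hω _
      rw [PHE.empirical_eq_count, hω]; simp
    · exact ae_of_all _ fun ω h => absurd h h0
  have hQint : ∀ J : Set 𝒳, MeasurableSet J → Q.real J = ∫ x in J, s x ∂μ := by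
    intro J hJ
    rw [Measure.real, hQ, withDensity_apply _ hJ, integral_eq_lintegral_of_nonneg_ae
      (ae_of_all _ hs_nonneg) hs_meas.aestronglyMeasurable]
  have hdev : ∀ ω, ∀ m ∈ 𝓜, ∀ m' ∈ 𝓜,
      PHE.hellSq μ (PHE.hist μ (fun i => X i ω) (PHE.join m m'))
        (PHE.blockMean μ s (PHE.join m m')) ≤ ENNReal.ofReal (pen m + pen m') +
        ENNReal.ofReal (4 / n) * PHE.devSum Q (fun i => X i ω) 𝓜 Δ := by
    intro ω m hm m' hm'
    refine (PHE.hellSq_piecewise_le (hmeas m hm m' hm') _ _ (PHE.empirical_nonneg _)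
      fun I => integral_nonneg hs_nonneg).trans ?_
    have : ∑ J ∈ (PHE.join m m').parts,
        (√(PHE.empirical (fun i => X i ω) J) - √(∫ x in J, s x ∂μ)) ^ 2 =
        PHE.empiricalDev Q (fun i => X i ω) (PHE.join m m') :=
      Finset.sum_congr rfl fun J hJ => by rw [hQint J (hmeas m hm m' hm' J hJ)]
    rw [this]
    exact PHE.ofReal_empiricalDev_join_le hn _ hm hm' (add_nonneg (hpen0 m hm) (hpen0 m' hm'))
      (hpenle m hm m' hm')
  have hbound : ∀ m ∈ 𝓜, ∀ t ∈ PHE.model μ m,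
      ∫⁻ ω, PHE.hellSq μ (PHE.hist μ (fun i => X i ω) (mhat ω)) s ∂P ≤
        390 * (PHE.hellSq μ s t + ENNReal.ofReal (pen m) + ENNReal.ofReal (101 * S ^ 2 / n)) +
          ENNReal.ofReal ε := by
    intro m hm t ht
    have hc : (100 : ℝ≥0∞) * ENNReal.ofReal (4 / n) ≠ ∞ := by finiteness
    calc ∫⁻ ω, PHE.hellSq μ (PHE.hist μ (fun i => X i ω) (mhat ω)) s ∂P
        ≤ ∫⁻ ω, ((200 * ENNReal.ofReal (pen m) + 112 * PHE.hellSq μ s t + ENNReal.ofReal ε) +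
            100 * ENNReal.ofReal (4 / n) * PHE.devSum Q (fun i => X i ω) 𝓜 Δ) ∂P := by
          refine lintegral_mono_ae ?_
          filter_upwards [hnull, hmhat] with ω h1 h2
          refine (PHE.hellSq_hist_selected_le hn h𝓜_meas h1 hs hpen0 (hdev ω) (hτ ω) h2 hm
            ht).trans (le_of_eq ?_)
          ring
      _ = (200 * ENNReal.ofReal (pen m) + 112 * PHE.hellSq μ s t + ENNReal.ofReal ε) +
            100 * ENNReal.ofReal (4 / n) * ∫⁻ ω, PHE.devSum Q (fun i => X i ω) 𝓜 Δ ∂P := by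
          -- The constant summand is the measurable one, so additivity asks nothing of `devSum`.
          rw [lintegral_add_left measurable_const, lintegral_const_mul' _ _ hc]
          simp
      _ ≤ (390 * ENNReal.ofReal (pen m) + 390 * PHE.hellSq μ s t + ENNReal.ofReal ε) +
            390 * ENNReal.ofReal (101 * S ^ 2 / n) := by
          refine add_le_add ?_ ?_
          · gcongr <;> norm_num
          · refine (mul_le_mul_right (PHE.lintegral_devSum_le hn hX_meas hX_indep hX_law
              h𝓜_count h𝓜_meas hS) _).trans ?_
            rw [← ENNReal.ofReal_ofNat 100, ← ENNReal.ofReal_ofNat 390,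
              ← ENNReal.ofReal_mul (by norm_num), ← ENNReal.ofReal_mul (by positivity),
              ← ENNReal.ofReal_mul (by norm_num)]
            refine ENNReal.ofReal_le_ofReal ?_
            -- The moment bound produces 400 S²/n, well below the 39390 S²/n allowed.
            rw [show (100 : ℝ) * (4 / n) * S ^ 2 = 400 * (S ^ 2 / n) by ring,
              show (390 : ℝ) * (101 * S ^ 2 / n) = 39390 * (S ^ 2 / n) by ring]
            have : 0 ≤ S ^ 2 / (n : ℝ) := by positivity
            linarith
      _ = _ := by ring
  simp only [PHE.hellSqSet, ENNReal.iInf_add,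
    ENNReal.mul_iInf_of_ne (a := 390) (by norm_num) (by norm_num)]
  exact le_iInf₂ fun m hm => le_iInf₂ fun t ht => hbound m hm t ht
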